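/- Let $H\in(0,1/2)$, $x_0>0$, $a>0$, $\sigma>0$, and let $B^H=\{B^H(t),\ t\ge 0\}$ be a fractional Brownian motion with Hurst index $H$ on a probability space, i.e. a centered Gaussian process with $$\mathbb E[B^H(t)B^H(s)]=\tfrac12\left(t^{2H}+s^{2H}-|t-s|^{2H}\right),\qquad s,t\ge 0,$$ with almost surely continuous paths. For $\varepsilon>0$ let $X^H_\varepsilon$ be the pathwise unique continuous solution of $$X^H_\varepsilon(t)=x_0+\int_0^t\frac{a}{X^H_\varepsilon(s)\mathbf 1_{\{X^H_\varepsilon(s)>0\}}+\varepsilon}\,ds+\sigma B^H(t),\qquad t\ge 0,$$ and put $$X^H(t):=\lim_{\varepsilon\downarrow 0}X^H_\varepsilon(t),\qquad L^H(t):=\lim_{\varepsilon\downarrow 0}\int_0^t\frac{1}{X^H_\varepsilon(s)\mathbf 1_{\{X^H_\varepsilon(s)>0\}}+\varepsilon}\,ds,\qquad R^H(t):=L^H(t)-\int_0^t\frac{ds}{X^H(s)}.$$ Then, with probability 1, these objects are well defined (both limits exist and are finite for every $t\ge 0$, $X^H(s)>0$ for almost every $s\ge 0$, and $1/X^H$ is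 integrable on $[0,t]$ for every $t\ge0$), and there exists $\tau>0$ (depending on the outcome) such that for all $t_2>t_1\ge\tau$ $$R^H(t_1)=R^H(t_2),\qquad L^H(t_2)-L^H(t_1)=\int_{t_1}^{t_2}\frac{ds}{X^H(s)},$$ and consequently $$X^H(t_2)-X^H(t_1)=a\int_{t_1}^{t_2}\frac{ds}{X^H(s)}+\sigma\left(B^H(t_2)-B^H(t_1)\right).$$ -/

import Mathlib

open MeasureTheory ProbabilityTheory Filter Topology Set
open scoped NNReal

noncomputable section

namespace RoughBessel

/-- `B` is a fractional Brownian motion with Hurst index `H`: a centered Gaussian process indexed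
by `[0, ∞)` with covariance `E[B(t) B(s)] = (t ^ (2H) + s ^ (2H) - |t - s| ^ (2H)) / 2`. Continuity
of the paths is not part of this definition. -/
structure IsFractionalBrownianMotion {Ω : Type*} [MeasurableSpace Ω] (H : ℝ)
    (B : ℝ≥0 → Ω → ℝ) (P : Measure Ω) : Prop where
  isGaussianProcess : IsGaussianProcess B P
  centered : ∀ t : ℝ≥0, ∫ ω, B t ω ∂P = 0
  covariance : ∀ s t : ℝ≥0, ∫ ω, B t ω * B s ω ∂P =
    ((t : ℝ) ^ (2 * H) + (s : ℝ) ^ (2 * H) - |(t : ℝ) - (s : ℝ)| ^ (2 * H)) / 2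

/-- The path `t ↦ B(t)(ω)` as a function of a real time variable; only times `t ≥ 0` matter. -/
def path {Ω : Type*} (B : ℝ≥0 → Ω → ℝ) (ω : Ω) : ℝ → ℝ := fun t => B t.toNNReal ω

/-- The regularized reciprocal `1 / (x 1_{x > 0} + ε)`. -/
def regInv (ε x : ℝ) : ℝ := 1 / ((if 0 < x then x else 0) + ε)

/-- `x` is a continuous solution on `[0, ∞)` of the pre-limit equation
`x(t) = x₀ + ∫₀ᵗ a / (x(s) 1_{x(s) > 0} + ε) ds + σ w(t)` driven by the path `w`. -/
structure IsPreLimitSolution (x₀ a σ ε : ℝ) (w x : ℝ → ℝ) : Prop where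
  continuousOn : ContinuousOn x (Ici 0)
  eq : ∀ t : ℝ, 0 ≤ t → x t = x₀ + (∫ s in (0 : ℝ)..t, a * regInv ε (x s)) + σ * w t

lemma regInv_eq (ε x : ℝ) : regInv ε x = 1 / (max x 0 + ε) := by
  unfold regInv
  split_ifs with h
  · rw [max_eq_left h.le]
  · rw [max_eq_right (not_lt.1 h)]

lemma regInv_abs_le {ε : ℝ} (hε : 0 < ε) (x : ℝ) : |regInv ε x| ≤ 1 / ε := by
  have h0 : 0 ≤ max x 0 := le_max_right _ _
  rw [regInv_eq, abs_of_nonneg (by positivity)]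
  exact one_div_le_one_div_of_le hε (by linarith)

lemma regInv_lipschitz {ε : ℝ} (hε : 0 < ε) (x y : ℝ) :
    |regInv ε x - regInv ε y| ≤ 1 / ε ^ 2 * |x - y| := by
  have hx : 0 ≤ max x 0 := le_max_right _ _
  have hy : 0 ≤ max y 0 := le_max_right _ _
  have hxy : |max y 0 - max x 0| ≤ |x - y| := by
    rw [abs_sub_comm x y]
    exact abs_max_sub_max_le_abs y x 0
  have e : regInv ε x - regInv ε y
      = (max y 0 - max x 0) / ((max x 0 + ε) * (max y 0 + ε)) := by
    rw [regInv_eq, regInv_eq]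
    have h1 : max x 0 + ε ≠ 0 := by positivity
    have h2 : max y 0 + ε ≠ 0 := by positivity
    field_simp
    ring
  have hp : ε ^ 2 ≤ (max x 0 + ε) * (max y 0 + ε) := by nlinarith [mul_nonneg hx hy]
  rw [e, abs_div, abs_of_pos (by positivity : 0 < (max x 0 + ε) * (max y 0 + ε)), one_div_mul_eq_div]
  exact div_le_div₀ (abs_nonneg _) hxy (by positivity) hp

lemma continuous_regInv {ε : ℝ} (hε : 0 < ε) : Continuous (regInv ε) := by
  have : regInv ε = fun x => 1 / (max x 0 + ε) := funext (regInv_eq ε)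
  rw [this]
  refine continuous_const.div (by fun_prop) fun x => ?_
  have : 0 ≤ max x 0 := le_max_right _ _
  positivity

/-- Vector field of the ordinary differential equation satisfied by `x - x₀ - σ w`. -/
def field (x₀ a σ ε : ℝ) (w : ℝ → ℝ) (t y : ℝ) : ℝ := a * regInv ε (y + x₀ + σ * w t)

lemma continuous_field {ε : ℝ} (x₀ a σ : ℝ) (hε : 0 < ε) {w : ℝ → ℝ} (hw : Continuous w) :
    Continuous (Function.uncurry (field x₀ a σ ε w)) := by
  have := continuous_regInv hε
  unfold Function.uncurry field
  fun_prop

lemma field_lipschitz {ε : ℝ} (x₀ a σ : ℝ) (hε : 0 < ε) (w : ℝ → ℝ) (t : ℝ) :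
    LipschitzWith (Real.toNNReal (|a| * (1 / ε ^ 2))) (field x₀ a σ ε w t) := by
  refine LipschitzWith.of_dist_le_mul fun y z => ?_
  rw [Real.coe_toNNReal _ (by positivity), Real.dist_eq, Real.dist_eq]
  unfold field
  rw [← mul_sub, abs_mul, mul_assoc]
  gcongr
  have := regInv_lipschitz hε (y + x₀ + σ * w t) (z + x₀ + σ * w t)
  simpa using this

lemma field_unique {ε : ℝ} (x₀ a σ : ℝ) (hε : 0 < ε) {w : ℝ → ℝ} {T : ℝ} {y z : ℝ → ℝ}
    (hy : ∀ t ∈ Icc 0 T, HasDerivWithinAt y (field x₀ a σ ε w t (y t)) (Icc 0 T) t)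
    (hz : ∀ t ∈ Icc 0 T, HasDerivWithinAt z (field x₀ a σ ε w t (z t)) (Icc 0 T) t)
    (h0 : y 0 = z 0) : EqOn y z (Icc 0 T) := by
  have key : ∀ {u : ℝ → ℝ},
      (∀ t ∈ Icc 0 T, HasDerivWithinAt u (field x₀ a σ ε w t (u t)) (Icc 0 T) t) →
      ∀ t ∈ Ico 0 T, HasDerivWithinAt u (field x₀ a σ ε w t (u t)) (Ici t) t := by
    intro u hu t ht
    refine (hu t ⟨ht.1, ht.2.le⟩).mono_of_mem_nhdsWithin ?_
    exact mem_of_superset (Icc_mem_nhdsGE ht.2) (Icc_subset_Icc_left ht.1)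
  exact ODE_solution_unique (fun t => field_lipschitz x₀ a σ hε w t)
    (fun t ht => (hy t ht).continuousWithinAt) (key hy)
    (fun t ht => (hz t ht).continuousWithinAt) (key hz) h0

lemma field_exists {ε : ℝ} (x₀ a σ : ℝ) (hε : 0 < ε) {w : ℝ → ℝ} (hw : Continuous w) {T : ℝ}
    (hT : 0 ≤ T) : ∃ y : ℝ → ℝ, y 0 = 0 ∧
      ∀ t ∈ Icc 0 T, HasDerivWithinAt y (field x₀ a σ ε w t (y t)) (Icc 0 T) t := by
  have hc := continuous_field x₀ a σ hε hw
  have hP : IsPicardLindelof (field x₀ a σ ε w) (tmin := 0) (tmax := T) ⟨0, left_mem_Icc.2 hT⟩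
      (0 : ℝ) (Real.toNNReal (|a| * (1 / ε) * T)) 0 (Real.toNNReal (|a| * (1 / ε)))
      (Real.toNNReal (|a| * (1 / ε ^ 2))) :=
    { lipschitzOnWith := fun t _ => (field_lipschitz x₀ a σ hε w t).lipschitzOnWith
      continuousOn := fun x _ =>
        (hc.comp (continuous_id.prodMk continuous_const)).continuousOn
      norm_le := fun t _ x _ => by
        rw [Real.coe_toNNReal _ (by positivity), Real.norm_eq_abs, field, abs_mul]
        gcongr
        exact regInv_abs_le hε _
      mul_max_le := by
        rw [Real.coe_toNNReal _ (by positivity), Real.coe_toNNReal _ (by positivity)]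
        simp [hT] }
  exact hP.exists_eq_forall_mem_Icc_hasDerivWithinAt₀

lemma IsPreLimitSolution.hasDerivWithinAt {x₀ a σ ε : ℝ} {w x : ℝ → ℝ} (hε : 0 < ε)
    (h : IsPreLimitSolution x₀ a σ ε w x) (T : ℝ) :
    ∀ t ∈ Icc 0 T, HasDerivWithinAt (fun t => x t - x₀ - σ * w t)
      (field x₀ a σ ε w t (x t - x₀ - σ * w t)) (Icc 0 T) t := by
  intro t ht
  have hcont : ContinuousOn (fun s => a * regInv ε (x s)) (Icc 0 T) :=
    continuousOn_const.mul
      ((continuous_regInv hε).comp_continuousOn (h.continuousOn.mono Icc_subset_Ici_self))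
  have : Fact (t ∈ Icc 0 T) := ⟨ht⟩
  have hd : HasDerivWithinAt (fun t => ∫ s in (0 : ℝ)..t, a * regInv ε (x s))
      (a * regInv ε (x t)) (Icc 0 T) t := by
    refine intervalIntegral.integral_hasDerivWithinAt_right ?_
      (hcont.stronglyMeasurableAtFilter_nhdsWithin measurableSet_Icc t) (hcont t ht)
    refine ContinuousOn.intervalIntegrable (hcont.mono ?_)
    rw [uIcc_of_le ht.1]
    exact Icc_subset_Icc_right ht.2
  have e : field x₀ a σ ε w t (x t - x₀ - σ * w t) = a * regInv ε (x t) := by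
    unfold field
    congr 2
    ring
  rw [e]
  refine hd.congr (fun s hs => ?_) ?_
  · rw [h.eq s hs.1]; ring
  · rw [h.eq t ht.1]; ring

lemma IsPreLimitSolution.unique {x₀ a σ ε : ℝ} {w x y : ℝ → ℝ} (hε : 0 < ε)
    (hx : IsPreLimitSolution x₀ a σ ε w x) (hy : IsPreLimitSolution x₀ a σ ε w y) :
    EqOn x y (Ici 0) := by
  intro t ht
  have := field_unique x₀ a σ hε (hx.hasDerivWithinAt hε t) (hy.hasDerivWithinAt hε t)
    (by have h1 := hx.eq 0 le_rfl
        have h2 := hy.eq 0 le_rfl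
        simp only [intervalIntegral.integral_same] at h1 h2
        rw [h1, h2]) (right_mem_Icc.2 ht)
  simpa using this

lemma exists_isPreLimitSolution {ε : ℝ} (x₀ a σ : ℝ) (hε : 0 < ε) {w : ℝ → ℝ}
    (hw : Continuous w) : ∃ x, IsPreLimitSolution x₀ a σ ε w x := by
  choose Y hY0 hY using fun n : ℕ => field_exists x₀ a σ hε hw (T := n) n.cast_nonneg
  have agree : ∀ {m n : ℕ}, m ≤ n → EqOn (Y m) (Y n) (Icc 0 m) := by
    intro m n hmn
    have hmn' : (m : ℝ) ≤ n := by exact_mod_cast hmn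
    refine field_unique x₀ a σ hε (hY m) (fun t ht => ?_) (by rw [hY0, hY0])
    exact (hY n t ⟨ht.1, ht.2.trans hmn'⟩).mono (Icc_subset_Icc_right hmn')
  let y : ℝ → ℝ := fun t => Y ⌈t⌉₊ t
  have hy : ∀ n : ℕ, EqOn y (Y n) (Icc 0 n) := fun n t ht =>
    agree (Nat.ceil_le.2 ht.2) ⟨ht.1, Nat.le_ceil t⟩
  have hyd : ∀ n : ℕ, ∀ t ∈ Icc (0 : ℝ) n,
      HasDerivWithinAt y (field x₀ a σ ε w t (y t)) (Icc 0 n) t := by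
    intro n t ht
    rw [hy n ht]
    exact (hY n t ht).congr (hy n) (hy n ht)
  have hyc : ContinuousOn y (Ici 0) := by
    intro t ht
    obtain ⟨n, hn⟩ := exists_nat_gt t
    refine (hyd n t ⟨ht, hn.le⟩).continuousWithinAt.mono_of_mem_nhdsWithin ?_
    rw [← Ici_inter_Iic]
    exact inter_mem self_mem_nhdsWithin (mem_nhdsWithin_of_mem_nhds (Iic_mem_nhds hn))
  refine ⟨fun t => y t + x₀ + σ * w t, by fun_prop, fun t ht => ?_⟩
  obtain ⟨n, hn⟩ := exists_nat_gt t
  have hy0 : y 0 = 0 := by rw [hy 0 (by simp), hY0]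
  have := ODE.picard_eq_of_hasDerivAt (f := field x₀ a σ ε w) (α := y) (t₀ := 0) (t := t)
    (u := univ) (continuous_field x₀ a σ hε hw).continuousOn (fun s hs => by
      rw [uIcc_of_le ht] at hs ⊢
      exact (hyd n s ⟨hs.1, hs.2.trans hn.le⟩).mono (Icc_subset_Icc_right hn.le))
    (mapsTo_univ _ _)
  rw [ODE.picard_apply, hy0, zero_add] at this
  simp only [field] at this
  rw [this]
  ring

open Classical in
/-- The pre-limit path `X_ε` driven by `w`: the solution of the pre-limit equation. For `ε > 0` and
continuous `w` it exists and is unique on `[0, ∞)`, see `isPreLimitSolution_preLimit` and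
`IsPreLimitSolution.unique`. -/
def preLimit (x₀ a σ : ℝ) (w : ℝ → ℝ) (ε : ℝ) : ℝ → ℝ :=
  if h : ∃ x, IsPreLimitSolution x₀ a σ ε w x then h.choose else 0

lemma isPreLimitSolution_preLimit {ε : ℝ} (x₀ a σ : ℝ) (hε : 0 < ε) {w : ℝ → ℝ}
    (hw : Continuous w) : IsPreLimitSolution x₀ a σ ε w (preLimit x₀ a σ w ε) := by
  have h := exists_isPreLimitSolution x₀ a σ hε hw
  rw [preLimit, dif_pos h]
  exact h.choose_spec

/-- The integral `∫₀ᵗ 1 / (X_ε(s) 1_{X_ε(s) > 0} + ε) ds`. -/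
def preL (x₀ a σ : ℝ) (w : ℝ → ℝ) (ε t : ℝ) : ℝ :=
  ∫ s in (0 : ℝ)..t, regInv ε (preLimit x₀ a σ w ε s)

/-- The rough Bessel path `X(t) = lim_{ε ↓ 0} X_ε(t)`. -/
def roughBessel (x₀ a σ : ℝ) (w : ℝ → ℝ) (t : ℝ) : ℝ :=
  limUnder (𝓝[>] (0 : ℝ)) fun ε => preLimit x₀ a σ w ε t

/-- `L(t) = lim_{ε ↓ 0} ∫₀ᵗ 1 / (X_ε(s) 1_{X_ε(s) > 0} + ε) ds`. -/
def processL (x₀ a σ : ℝ) (w : ℝ → ℝ) (t : ℝ) : ℝ :=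
  limUnder (𝓝[>] (0 : ℝ)) fun ε => preL x₀ a σ w ε t

/-- `R(t) = L(t) - ∫₀ᵗ ds / X(s)`. -/
def processR (x₀ a σ : ℝ) (w : ℝ → ℝ) (t : ℝ) : ℝ :=
  processL x₀ a σ w t - ∫ s in (0 : ℝ)..t, 1 / roughBessel x₀ a σ w s

end RoughBessel

end

namespace RoughBessel

variable {x₀ a σ ε : ℝ} {w x : ℝ → ℝ}

/-! Apart from the growth of `B`, everything is pathwise. Comparison (`le_of_le`) makes `X_ε`
increase as `ε ↓ 0`, and `exists_forall_le` bounds it locally, so `X` exists; `L` follows because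
`X_ε` is affine in the integral defining it. Fatou's lemma then makes the lower limit of the
regularized reciprocals locally integrable, which gives `X > 0` almost everywhere and integrability
of `1 / X`.

Fatou alone allows a loss of mass, measured by `R`. The loss stops once `X_ε` stays away from zero
uniformly in `ε`. By `le_drift`, the repulsion forces the drift up to order `√T` by time `T` as long
as the noise is of smaller order. Since `H < 1/2`, fractional Brownian motion is almost surely
`o(√T)`: Gaussian moments and dyadic chaining on every `[0, 2 ^ N]` (`ae_exists_abs_sub_le`) bound
it by `C * b ^ N` with `2 ^ H < b < √2`. From a random time on, `X_ε ≥ 1` for all `ε ≤ 1`, and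
dominated convergence (`processL_sub_processL`) replaces Fatou. -/

lemma regInv_pos (hε : 0 < ε) (x : ℝ) : 0 < regInv ε x := by
  have := le_max_right x 0
  rw [regInv_eq]
  positivity

lemma regInv_le_regInv {ε₁ ε₂ x y : ℝ} (hε : 0 < ε₁) (h : ε₁ ≤ ε₂) (hxy : x ≤ y) :
    regInv ε₂ y ≤ regInv ε₁ x := by
  have := le_max_right x 0
  rw [regInv_eq, regInv_eq]
  exact one_div_le_one_div_of_le (by positivity) (add_le_add (max_le_max_right 0 hxy) h)

lemma regInv_le_one (hε : 0 < ε) {x : ℝ} (hx : 1 ≤ x) : regInv ε x ≤ 1 := by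
  have := le_max_left x 0
  rw [regInv_eq, div_le_one (by linarith)]
  linarith

lemma tendsto_regInv {ι : Type*} {l : Filter ι} {e x : ι → ℝ} {y : ℝ} (he : Tendsto e l (𝓝 0))
    (hx : Tendsto x l (𝓝 y)) (hy : 0 < y) :
    Tendsto (fun i => regInv (e i) (x i)) l (𝓝 (1 / y)) := by
  simp only [regInv_eq]
  have h : Tendsto (fun i => max (x i) 0 + e i) l (𝓝 (max y 0 + 0)) :=
    (hx.max tendsto_const_nhds).add he
  rw [add_zero, max_eq_left hy.le] at h
  exact tendsto_const_nhds.div h hy.ne'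

/-! ### Pathwise comparison and bounds for the regularized equation -/

namespace IsPreLimitSolution

lemma hasDerivWithinAt_Ici (hε : 0 < ε) (h : IsPreLimitSolution x₀ a σ ε w x) {t : ℝ}
    (ht : 0 ≤ t) :
    HasDerivWithinAt (fun t => x t - x₀ - σ * w t) (a * regInv ε (x t)) (Ici t) t := by
  have := h.hasDerivWithinAt hε (t + 1) t ⟨ht, by linarith⟩
  have e : field x₀ a σ ε w t (x t - x₀ - σ * w t) = a * regInv ε (x t) := by
    unfold field
    congr 2
    ring
  rw [e] at this
  refine this.mono_of_mem_nhdsWithin ?_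
  exact mem_of_superset (Icc_mem_nhdsGE (by linarith)) (Icc_subset_Icc_left ht)

lemma continuousOn_drift (hε : 0 < ε) (h : IsPreLimitSolution x₀ a σ ε w x) (T : ℝ) :
    ContinuousOn (fun t => x t - x₀ - σ * w t) (Icc 0 T) :=
  fun t ht => (h.hasDerivWithinAt hε T t ht).continuousWithinAt

lemma apply_zero (h : IsPreLimitSolution x₀ a σ ε w x) : x 0 - x₀ - σ * w 0 = 0 := by
  have := h.eq 0 le_rfl
  rw [intervalIntegral.integral_same] at this
  linarith

lemma continuousOn_regInv (hε : 0 < ε) (h : IsPreLimitSolution x₀ a σ ε w x) :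
    ContinuousOn (fun s => regInv ε (x s)) (Ici 0) :=
  (continuous_regInv hε).comp_continuousOn h.continuousOn

lemma intervalIntegrable_regInv (hε : 0 < ε) (h : IsPreLimitSolution x₀ a σ ε w x) {s t : ℝ}
    (hs : 0 ≤ s) (ht : 0 ≤ t) : IntervalIntegrable (fun s => regInv ε (x s)) volume s t :=
  ((h.continuousOn_regInv hε).mono fun _ hu => le_trans (le_min hs ht) hu.1).intervalIntegrable

/-- Solutions decrease when the regularization parameter increases. -/
lemma le_of_le {ε₁ ε₂ : ℝ} {y : ℝ → ℝ} (ha : 0 ≤ a) (hε : 0 < ε₁) (h : ε₁ ≤ ε₂)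
    (hx : IsPreLimitSolution x₀ a σ ε₁ w x) (hy : IsPreLimitSolution x₀ a σ ε₂ w y) {t : ℝ}
    (ht : 0 ≤ t) : y t ≤ x t := by
  have hε₂ : 0 < ε₂ := hε.trans_le h
  refine le_of_forall_pos_le_add fun η hη => ?_
  set δ := η / (1 + t) with hδ
  have hδ0 : 0 < δ := by positivity
  -- The barrier `δ * (1 + t)` is positive with slope `δ > 0`. Where the difference touches it, `y >
  -- x`, so the difference has nonpositive derivative and cannot cross.
  have key := image_le_of_deriv_right_lt_deriv_boundary'
    (f := fun t => (y t - x₀ - σ * w t) - (x t - x₀ - σ * w t))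
    (f' := fun t => a * regInv ε₂ (y t) - a * regInv ε₁ (x t)) (a := 0) (b := t)
    (B := fun t => δ * (1 + t)) (B' := fun _ => δ)
    ((hy.continuousOn_drift hε₂ t).sub (hx.continuousOn_drift hε t))
    (fun s hs => (hy.hasDerivWithinAt_Ici hε₂ hs.1).sub (hx.hasDerivWithinAt_Ici hε hs.1))
    (by simp only [hx.apply_zero, hy.apply_zero]; linarith) (by fun_prop)
    (fun s _ => by
      simpa using (((hasDerivAt_id s).const_add 1).const_mul δ).hasDerivWithinAt)
    (fun s hs he => by
      have h1 : 0 < δ * (1 + s) := mul_pos hδ0 (by linarith [hs.1])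
      have h2 := mul_le_mul_of_nonneg_left
        (regInv_le_regInv hε h (show x s ≤ y s by linarith)) ha
      linarith)
    (right_mem_Icc.2 ht)
  have : δ * (1 + t) = η := by rw [hδ]; field_simp
  linarith

/-- On a bounded time interval, solutions are bounded above uniformly in the regularization
parameter. -/
lemma exists_forall_le (x₀ σ T : ℝ) (ha : 0 ≤ a) (hw : Continuous w) :
    ∃ M, ∀ ε x, 0 < ε → IsPreLimitSolution x₀ a σ ε w x → ∀ t ∈ Icc 0 T, x t ≤ M := by
  obtain ⟨C, hC⟩ := (isCompact_Icc (a := 0) (b := T)).exists_bound_of_continuousOn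
    (f := fun t => x₀ + σ * w t) (by fun_prop)
  simp only [Real.norm_eq_abs, abs_le] at hC
  refine ⟨C + (|C| + 1 + (a + 1) * T), fun ε x hε h t ht => ?_⟩
  -- At a contact with the barrier, `x ≥ 1` because `|C| + 1` absorbs `x₀ + σ * w`; the drift then
  -- has slope at most `a < a + 1`, whatever `ε` is.
  have key := image_le_of_deriv_right_lt_deriv_boundary'
    (f := fun t => x t - x₀ - σ * w t) (f' := fun t => a * regInv ε (x t)) (a := 0) (b := t)
    (B := fun t => |C| + 1 + (a + 1) * t) (B' := fun _ => a + 1)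
    (h.continuousOn_drift hε t) (fun s hs => h.hasDerivWithinAt_Ici hε hs.1)
    (by simp only [h.apply_zero]; positivity) (by fun_prop)
    (fun s _ => by
      simpa using (((hasDerivAt_id s).const_mul (a + 1)).const_add (|C| + 1)).hasDerivWithinAt)
    (fun s hs he => by
      have h1 := (hC s ⟨hs.1, hs.2.le.trans ht.2⟩).1
      have h2 : 0 ≤ (a + 1) * s := mul_nonneg (by linarith) hs.1
      have h3 := regInv_le_one hε (x := x s) (by linarith [le_abs_self C])
      nlinarith)
    (right_mem_Icc.2 ht.1)
  have h1 := (hC t ht).2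
  have h2 : (a + 1) * t ≤ (a + 1) * T := mul_le_mul_of_nonneg_left ht.2 (by linarith)
  linarith

/-- A lower bound for the drift part of a solution at a time that is large compared with the size
of the driving path. -/
lemma le_drift {K T : ℝ} (ha : 0 < a) (hε : 0 < ε) (h : IsPreLimitSolution x₀ a σ ε w x)
    (hT : 0 ≤ T) (hK : ε ≤ K) (hw : ∀ s ∈ Icc 0 T, x₀ + σ * w s + ε ≤ K)
    (haT : 2 * K ^ 2 ≤ a * T) : K ≤ x T - x₀ - σ * w T := by
  -- The drift is nondecreasing, so being below `K` at `T` it is at most `K` on all of `[0, T]`.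
  -- Then `x + ε ≤ 2 * K` there, and the drift at `T` is at least `a * T / (2 * K) ≥ K`.
  by_contra! hlt
  have hK0 : 0 < K := hε.trans_le hK
  have hint : ∀ {s t : ℝ}, 0 ≤ s → 0 ≤ t →
      IntervalIntegrable (fun s => a * regInv ε (x s)) volume s t := fun hs ht =>
    (h.intervalIntegrable_regInv hε hs ht).const_mul a
  have hmono : ∀ s ∈ Icc 0 T, x s - x₀ - σ * w s ≤ K := by
    intro s hs
    have h1 := intervalIntegral.integral_add_adjacent_intervals (hint le_rfl hs.1) (hint hs.1 hT)
    have h2 : 0 ≤ ∫ u in s..T, a * regInv ε (x u) :=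
      intervalIntegral.integral_nonneg hs.2 fun u _ => (mul_pos ha (regInv_pos hε _)).le
    rw [h.eq s hs.1]
    rw [h.eq T hT] at hlt
    linarith
  have hlow : ∀ s ∈ Icc 0 T, a * (1 / (2 * K)) ≤ a * regInv ε (x s) := by
    intro s hs
    refine mul_le_mul_of_nonneg_left ?_ ha.le
    rw [regInv_eq]
    refine one_div_le_one_div_of_le (by positivity) ?_
    rw [← le_sub_iff_add_le]
    exact max_le (by linarith [hmono s hs, hw s hs]) (by linarith)
  have h1 := intervalIntegral.integral_mono_on hT (by simp) (hint le_rfl hT) hlow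
  have h2 : K ≤ T * (a * (1 / (2 * K))) := by
    rw [show T * (a * (1 / (2 * K))) = a * T / (2 * K) by ring, le_div_iff₀ (by positivity)]
    linarith
  rw [intervalIntegral.integral_const, sub_zero, smul_eq_mul] at h1
  rw [h.eq T hT] at hlt
  linarith

end IsPreLimitSolution

/-! ### The limit `ε ↓ 0`: existence, positivity and integrability -/

lemma tendsto_preLimit (x₀ σ : ℝ) (ha : 0 ≤ a) (hw : Continuous w) {t : ℝ} (ht : 0 ≤ t) :
    Tendsto (fun ε => preLimit x₀ a σ w ε t) (𝓝[>] 0) (𝓝 (roughBessel x₀ a σ w t)) := by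
  obtain ⟨M, hM⟩ := IsPreLimitSolution.exists_forall_le x₀ σ t ha hw
  have hanti : AntitoneOn (fun ε => preLimit x₀ a σ w ε t) (Ioi 0) := fun ε₁ h₁ ε₂ h₂ h =>
    (isPreLimitSolution_preLimit x₀ a σ h₁ hw).le_of_le ha h₁ h
      (isPreLimitSolution_preLimit x₀ a σ h₂ hw) ht
  have hbdd : BddAbove ((fun ε => preLimit x₀ a σ w ε t) '' Ioi 0) := by
    refine ⟨M, ?_⟩
    rintro _ ⟨ε, hε, rfl⟩
    exact hM ε _ hε (isPreLimitSolution_preLimit x₀ a σ hε hw) t (right_mem_Icc.2 ht)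
  exact tendsto_nhds_limUnder ⟨_, hanti.tendsto_nhdsGT hbdd⟩

lemma preLimit_le_roughBessel (x₀ σ : ℝ) (ha : 0 ≤ a) (hw : Continuous w) (hε : 0 < ε) {t : ℝ}
    (ht : 0 ≤ t) : preLimit x₀ a σ w ε t ≤ roughBessel x₀ a σ w t := by
  refine ge_of_tendsto (tendsto_preLimit x₀ σ ha hw ht) ?_
  filter_upwards [Ioo_mem_nhdsGT hε] with ε' h
  exact (isPreLimitSolution_preLimit x₀ a σ h.1 hw).le_of_le ha h.1 h.2.le
    (isPreLimitSolution_preLimit x₀ a σ hε hw) ht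

lemma preLimit_eq (x₀ σ : ℝ) (hw : Continuous w) (hε : 0 < ε) {t : ℝ} (ht : 0 ≤ t) :
    preLimit x₀ a σ w ε t = x₀ + a * preL x₀ a σ w ε t + σ * w t := by
  rw [(isPreLimitSolution_preLimit x₀ a σ hε hw).eq t ht, preL,
    intervalIntegral.integral_const_mul]

lemma tendsto_preL (x₀ σ : ℝ) (ha : 0 < a) (hw : Continuous w) {t : ℝ} (ht : 0 ≤ t) :
    Tendsto (fun ε => preL x₀ a σ w ε t) (𝓝[>] 0) (𝓝 (processL x₀ a σ w t)) := by
  refine tendsto_nhds_limUnder ⟨(roughBessel x₀ a σ w t - x₀ - σ * w t) / a, ?_⟩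
  refine Tendsto.congr' ?_ ((((tendsto_preLimit x₀ σ ha.le hw ht).sub_const x₀).sub_const
    (σ * w t)).div_const a)
  filter_upwards [self_mem_nhdsWithin] with ε hε
  rw [preLimit_eq x₀ σ hw hε ht]
  field_simp
  ring

lemma roughBessel_eq (x₀ σ : ℝ) (ha : 0 < a) (hw : Continuous w) {t : ℝ} (ht : 0 ≤ t) :
    roughBessel x₀ a σ w t = x₀ + a * processL x₀ a σ w t + σ * w t := by
  refine tendsto_nhds_unique (tendsto_preLimit x₀ σ ha.le hw ht) (Tendsto.congr' ?_
    ((((tendsto_preL x₀ σ ha hw ht).const_mul a).const_add x₀).add_const (σ * w t)))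
  filter_upwards [self_mem_nhdsWithin] with ε hε
  rw [preLimit_eq x₀ σ hw hε ht]

lemma one_div_add_one_pos (n : ℕ) : (0 : ℝ) < 1 / (n + 1) := by positivity

lemma tendsto_one_div_add_one_nhdsGT :
    Tendsto (fun n : ℕ => (1 : ℝ) / (n + 1)) atTop (𝓝[>] 0) :=
  tendsto_nhdsWithin_iff.2
    ⟨tendsto_one_div_add_atTop_nhds_zero_nat, .of_forall one_div_add_one_pos⟩

/-- By Fatou's lemma the regularized reciprocals have a locally integrable lower limit. -/
lemma lintegral_liminf_regInv_lt_top (x₀ σ : ℝ) (ha : 0 < a) (hw : Continuous w) {T : ℝ}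
    (hT : 0 ≤ T) :
    ∫⁻ s in Ioc 0 T, liminf (fun n : ℕ => ENNReal.ofReal
      (regInv (1 / (n + 1)) (preLimit x₀ a σ w (1 / (n + 1)) s))) atTop < ⊤ := by
  have hsol := fun n : ℕ => isPreLimitSolution_preLimit x₀ a σ (one_div_add_one_pos n) hw
  have hcont := fun n : ℕ => ((hsol n).continuousOn_regInv (one_div_add_one_pos n)).mono
    (t := Ioc 0 T) fun s hs => hs.1.le
  refine (lintegral_liminf_le' fun n =>
    ((hcont n).aemeasurable measurableSet_Ioc).ennreal_ofReal).trans_lt ?_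
  have heq : ∀ n : ℕ, ∫⁻ s in Ioc 0 T, ENNReal.ofReal
      (regInv (1 / (n + 1)) (preLimit x₀ a σ w (1 / (n + 1)) s)) =
      ENNReal.ofReal (preL x₀ a σ w (1 / (n + 1)) T) := by
    intro n
    rw [preL, intervalIntegral.integral_of_le hT, ofReal_integral_eq_lintegral_ofReal]
    · exact ((hsol n).intervalIntegrable_regInv (one_div_add_one_pos n) le_rfl hT).1
    · exact .of_forall fun s => (regInv_pos (one_div_add_one_pos n) _).le
  simp only [heq]
  have hlim : Tendsto (fun n : ℕ => preL x₀ a σ w (1 / (n + 1)) T) atTop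
      (𝓝 (processL x₀ a σ w T)) :=
    (tendsto_preL x₀ σ ha hw hT).comp tendsto_one_div_add_one_nhdsGT
  rw [(ENNReal.tendsto_ofReal hlim).liminf_eq]
  exact ENNReal.ofReal_lt_top

lemma aemeasurable_liminf_regInv (x₀ a σ : ℝ) (hw : Continuous w) (T : ℝ) :
    AEMeasurable (fun s => liminf (fun n : ℕ => ENNReal.ofReal
      (regInv (1 / (n + 1)) (preLimit x₀ a σ w (1 / (n + 1)) s))) atTop)
      (volume.restrict (Ioc 0 T)) := by
  simp only [liminf_eq_iSup_iInf_of_nat']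
  refine AEMeasurable.iSup fun m => AEMeasurable.iInf fun k => (ContinuousOn.aemeasurable ?_
    measurableSet_Ioc).ennreal_ofReal
  exact ((isPreLimitSolution_preLimit x₀ a σ (one_div_add_one_pos _) hw).continuousOn_regInv
    (one_div_add_one_pos _)).mono fun s hs => hs.1.le

/-- By monotonicity every `X_ε(s)` lies below `X(s) ≤ 0`, so the regularized reciprocal is exactly
`1 / ε`. With the Fatou bound, this confines such `s` to a null set. -/
lemma liminf_regInv_eq_top (x₀ σ : ℝ) (ha : 0 ≤ a) (hw : Continuous w) {s : ℝ} (hs : 0 ≤ s)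
    (hX : roughBessel x₀ a σ w s ≤ 0) :
    liminf (fun n : ℕ => ENNReal.ofReal
      (regInv (1 / (n + 1)) (preLimit x₀ a σ w (1 / (n + 1)) s))) atTop = ⊤ := by
  have h : ∀ n : ℕ, regInv (1 / (n + 1)) (preLimit x₀ a σ w (1 / (n + 1)) s) = n + 1 := by
    intro n
    rw [regInv_eq, max_eq_right ((preLimit_le_roughBessel x₀ σ ha hw
      (one_div_add_one_pos n) hs).trans hX), zero_add, one_div_one_div]
  simp only [h]
  refine Tendsto.liminf_eq (ENNReal.tendsto_ofReal_atTop.comp ?_)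
  exact tendsto_natCast_atTop_atTop.atTop_add tendsto_const_nhds

lemma ae_roughBessel_pos_Ioc (x₀ σ : ℝ) (ha : 0 < a) (hw : Continuous w) {T : ℝ} (hT : 0 ≤ T) :
    ∀ᵐ s ∂(volume.restrict (Ioc 0 T)), 0 < roughBessel x₀ a σ w s := by
  filter_upwards [ae_lt_top' (aemeasurable_liminf_regInv x₀ a σ hw T)
    (lintegral_liminf_regInv_lt_top x₀ σ ha hw hT).ne, ae_restrict_mem measurableSet_Ioc]
    with s hs hsT
  by_contra! hneg
  exact hs.ne (liminf_regInv_eq_top x₀ σ ha.le hw hsT.1.le hneg)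

lemma ae_roughBessel_pos (x₀ σ : ℝ) (ha : 0 < a) (hw : Continuous w) :
    ∀ᵐ s ∂(volume.restrict (Ici (0 : ℝ))), 0 < roughBessel x₀ a σ w s := by
  rw [← restrict_Ioi_eq_restrict_Ici, ae_restrict_iff' measurableSet_Ioi]
  have h : ∀ᵐ s : ℝ, ∀ n : ℕ, s ∈ Ioc (0 : ℝ) n → 0 < roughBessel x₀ a σ w s :=
    ae_all_iff.2 fun n => (ae_restrict_iff' measurableSet_Ioc).1
      (ae_roughBessel_pos_Ioc x₀ σ ha hw n.cast_nonneg)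
  filter_upwards [h] with s hs hs0
  obtain ⟨n, hn⟩ := exists_nat_ge s
  exact hs n ⟨hs0, hn⟩

lemma intervalIntegrable_one_div_roughBessel (x₀ σ : ℝ) (ha : 0 < a) (hw : Continuous w) {T : ℝ}
    (hT : 0 ≤ T) :
    IntervalIntegrable (fun s => 1 / roughBessel x₀ a σ w s) volume 0 T := by
  have hlim : ∀ᵐ s ∂(volume.restrict (Ioc 0 T)), Tendsto
      (fun n : ℕ => regInv (1 / (n + 1)) (preLimit x₀ a σ w (1 / (n + 1)) s)) atTop
      (𝓝 (1 / roughBessel x₀ a σ w s)) := by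
    filter_upwards [ae_roughBessel_pos_Ioc x₀ σ ha hw hT, ae_restrict_mem measurableSet_Ioc]
      with s hs hsT
    exact tendsto_regInv tendsto_one_div_add_atTop_nhds_zero_nat
      ((tendsto_preLimit x₀ σ ha.le hw hsT.1.le).comp tendsto_one_div_add_one_nhdsGT) hs
  rw [intervalIntegrable_iff_integrableOn_Ioc_of_le hT]
  refine ⟨aestronglyMeasurable_of_tendsto_ae atTop (fun n => ?_) hlim, ?_⟩
  · exact (((isPreLimitSolution_preLimit x₀ a σ (one_div_add_one_pos n) hw).continuousOn_regInv
      (one_div_add_one_pos n)).mono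
      fun s hs => hs.1.le).aestronglyMeasurable measurableSet_Ioc
  · refine lt_of_le_of_lt (le_of_eq (lintegral_congr_ae ?_))
      (lintegral_liminf_regInv_lt_top x₀ σ ha hw hT)
    filter_upwards [hlim, ae_roughBessel_pos_Ioc x₀ σ ha hw hT] with s hs hpos
    rw [(ENNReal.tendsto_ofReal hs).liminf_eq,
      Real.enorm_of_nonneg (by positivity)]

/-! ### No loss of mass at large times -/

/-- If the driving path grows slower than a small multiple of the square root of the time, then the
pre-limit paths with `ε ≤ 1` are eventually bounded away from zero. -/
lemma eventually_one_le_preLimit {T₀ : ℝ} (hx₀ : 0 ≤ x₀) (ha : 0 < a) (hw : Continuous w)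
    (hT₀ : 0 ≤ T₀)
    (hgrow : ∀ T, T₀ ≤ T → ∀ s ∈ Icc 0 T, |σ * w s| + x₀ + 2 ≤ √(a * T / 2)) (hε : 0 < ε)
    (hε1 : ε ≤ 1) {t : ℝ} (ht : T₀ ≤ t) : 1 ≤ preLimit x₀ a σ w ε t := by
  have ht0 : 0 ≤ t := hT₀.trans ht
  -- Monotonicity in `ε` reduces to `ε = 1`, which makes the bound uniform.
  refine le_trans ?_ ((isPreLimitSolution_preLimit x₀ a σ hε hw).le_of_le ha.le hε hε1
    (isPreLimitSolution_preLimit x₀ a σ one_pos hw) ht0)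
  have hlast := hgrow t ht t (right_mem_Icc.2 ht0)
  -- This `K` satisfies `2 * K ^ 2 = a * t`, equality in the hypothesis of `le_drift`.
  have h := (isPreLimitSolution_preLimit x₀ a σ one_pos hw).le_drift (K := √(a * t / 2)) ha
    one_pos ht0 (by linarith [abs_nonneg (σ * w t)])
    (fun s hs => by linarith [hgrow t ht s hs, le_abs_self (σ * w s)])
    (by rw [Real.sq_sqrt (by positivity)]; linarith)
  linarith [neg_abs_le (σ * w t)]

/-- Beyond `T₀` the regularized reciprocals with `ε < 1` are at most `1`, so the constant `1` is a
dominating function and limit and integral commute. -/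
lemma processL_sub_processL {T₀ : ℝ} (hx₀ : 0 ≤ x₀) (ha : 0 < a) (hw : Continuous w)
    (hT₀ : 0 ≤ T₀)
    (hgrow : ∀ T, T₀ ≤ T → ∀ s ∈ Icc 0 T, |σ * w s| + x₀ + 2 ≤ √(a * T / 2)) {t₁ t₂ : ℝ}
    (h₁ : T₀ ≤ t₁) (h₂ : t₁ ≤ t₂) :
    processL x₀ a σ w t₂ - processL x₀ a σ w t₁ =
      ∫ s in t₁..t₂, 1 / roughBessel x₀ a σ w s := by
  have ht₁ : 0 ≤ t₁ := hT₀.trans h₁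
  have ht₂ : 0 ≤ t₂ := ht₁.trans h₂
  refine tendsto_nhds_unique
    ((tendsto_preL x₀ σ ha hw ht₂).sub (tendsto_preL x₀ σ ha hw ht₁)) ?_
  have hev : ∀ᶠ ε : ℝ in 𝓝[>] 0, ε ∈ Ioo (0 : ℝ) 1 := Ioo_mem_nhdsGT one_pos
  have hdom : Tendsto (fun ε => ∫ s in t₁..t₂, regInv ε (preLimit x₀ a σ w ε s)) (𝓝[>] 0)
      (𝓝 (∫ s in t₁..t₂, 1 / roughBessel x₀ a σ w s)) := by
    refine intervalIntegral.tendsto_integral_filter_of_dominated_convergence (fun _ => 1) ?_ ?_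
      (by simp) ?_
    · filter_upwards [hev] with ε hε
      rw [uIoc_of_le h₂]
      exact ((isPreLimitSolution_preLimit x₀ a σ hε.1 hw).intervalIntegrable_regInv hε.1 ht₁
        ht₂).1.aestronglyMeasurable
    · filter_upwards [hev] with ε hε
      refine .of_forall fun s hs => ?_
      rw [uIoc_of_le h₂] at hs
      rw [Real.norm_of_nonneg (regInv_pos hε.1 _).le]
      exact regInv_le_one hε.1
        (eventually_one_le_preLimit hx₀ ha hw hT₀ hgrow hε.1 hε.2.le (h₁.trans hs.1.le))
    · refine .of_forall fun s hs => ?_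
      rw [uIoc_of_le h₂] at hs
      refine tendsto_regInv (tendsto_id.mono_left nhdsWithin_le_nhds)
        (tendsto_preLimit x₀ σ ha.le hw (ht₁.trans hs.1.le)) (one_pos.trans_le ?_)
      exact (eventually_one_le_preLimit hx₀ ha hw hT₀ hgrow one_pos le_rfl
        (h₁.trans hs.1.le)).trans
        (preLimit_le_roughBessel x₀ σ ha.le hw one_pos (ht₁.trans hs.1.le))
  refine hdom.congr' ?_
  filter_upwards [hev] with ε hε
  have hsol := isPreLimitSolution_preLimit x₀ a σ hε.1 hw
  exact (intervalIntegral.integral_interval_sub_left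
    (hsol.intervalIntegrable_regInv hε.1 le_rfl ht₂)
    (hsol.intervalIntegrable_regInv hε.1 le_rfl ht₁)).symm

/-! ### Dyadic chaining -/

/-- Induction on the level: an even index is a point of the coarser grid, and an odd one is a single
fine step away from such a point. -/
lemma abs_sub_le_of_dyadic {g : ℝ → ℝ} {A r : ℝ} (hA : 0 ≤ A) (hr : 0 ≤ r)
    (h : ∀ n j : ℕ, j < 2 ^ n →
      |g (((j + 1 : ℕ) : ℝ) / 2 ^ n) - g ((j : ℝ) / 2 ^ n)| ≤ A * r ^ n) (n : ℕ) :
    ∀ j : ℕ, j ≤ 2 ^ n →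
      |g ((j : ℝ) / 2 ^ n) - g 0| ≤ A * ∑ i ∈ Finset.range (n + 1), r ^ i := by
  induction n with
  | zero =>
    intro j hj
    interval_cases j
    · simpa using hA
    · simpa using h 0 0 one_pos
  | succ n ih =>
    have half : ∀ i : ℕ, ((i + i : ℕ) : ℝ) / 2 ^ (n + 1) = (i : ℝ) / 2 ^ n := by
      intro i
      push_cast
      field_simp
      ring
    intro j hj
    rw [Finset.sum_range_succ, mul_add]
    rcases Nat.even_or_odd' j with ⟨i, rfl | rfl⟩
    · rw [two_mul, half]
      have := ih i (by rw [pow_succ] at hj; omega)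
      have : 0 ≤ A * r ^ (n + 1) := by positivity
      linarith
    · have h1 := ih i (by rw [pow_succ] at hj; omega)
      have h2 := h (n + 1) (i + i) (by omega)
      rw [half] at h2
      rw [two_mul]
      have := abs_sub_le (g (((i + i + 1 : ℕ) : ℝ) / 2 ^ (n + 1))) (g ((i : ℝ) / 2 ^ n)) (g 0)
      linarith

/-- Chaining over dyadic points. -/
lemma abs_sub_le_of_continuous {g : ℝ → ℝ} {A r : ℝ} (hg : Continuous g) (hr : 0 ≤ r) (hr1 : r < 1)
    (h : ∀ n j : ℕ, j < 2 ^ n →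
      |g (((j + 1 : ℕ) : ℝ) / 2 ^ n) - g ((j : ℝ) / 2 ^ n)| ≤ A * r ^ n) {t : ℝ}
    (ht : t ∈ Icc 0 1) : |g t - g 0| ≤ A * (1 - r)⁻¹ := by
  have hA : 0 ≤ A := by simpa using (abs_nonneg _).trans (h 0 0 one_pos)
  -- Dyadic points approximate `t` from below, and continuity of `g` carries the bound to the limit.
  have hlim : Tendsto (fun n : ℕ => ((⌊t * 2 ^ n⌋₊ : ℕ) : ℝ) / 2 ^ n) atTop (𝓝 t) :=
    (tendsto_nat_floor_mul_div_atTop ht.1).comp (tendsto_pow_atTop_atTop_of_one_lt one_lt_two)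
  refine le_of_tendsto (((hg.tendsto t).comp hlim).sub_const (g 0)).abs (.of_forall fun n => ?_)
  refine (abs_sub_le_of_dyadic hA hr h n _ ?_).trans (mul_le_mul_of_nonneg_left ?_ hA)
  · refine Nat.floor_le_of_le ?_
    push_cast
    exact mul_le_of_le_one_left (by positivity) ht.2
  · rw [← tsum_geometric_of_lt_one hr hr1]
    exact (summable_geometric_of_lt_one hr hr1).sum_le_tsum _ fun i _ => by positivity

/-! ### Moments and almost sure growth of fractional Brownian motion -/

/-- The `p`-th absolute moment of the standard Gaussian distribution. -/
noncomputable def gaussianMoment (p : ℕ) : ENNReal :=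
  ∫⁻ x, ENNReal.ofReal (|x| ^ p) ∂gaussianReal 0 1

lemma gaussianMoment_ne_top (p : ℕ) : gaussianMoment p ≠ ⊤ := by
  have h := (memLp_id_gaussianReal' (μ := 0) (v := 1) (p : ENNReal)
    (ENNReal.natCast_ne_top p)).integrable_norm_pow'
  exact h.lintegral_lt_top.ne

variable {Ω : Type*} [MeasurableSpace Ω] {P : Measure Ω} {H : ℝ} {B : ℝ≥0 → Ω → ℝ}

lemma lintegral_abs_pow_of_hasGaussianLaw [IsProbabilityMeasure P] {Y : Ω → ℝ}
    (hY : HasGaussianLaw Y P) (h0 : ∫ ω, Y ω ∂P = 0) {c : ℝ} (hc : 0 ≤ c)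
    (h2 : ∫ ω, Y ω ^ 2 ∂P = c ^ 2) (p : ℕ) :
    ∫⁻ ω, ENNReal.ofReal (|Y ω| ^ p) ∂P = ENNReal.ofReal (c ^ p) * gaussianMoment p := by
  have hmap : P.map Y = (gaussianReal 0 1).map (c * ·) := by
    rw [hY.map_eq_gaussianReal, gaussianReal_map_const_mul, h0,
      variance_of_integral_eq_zero hY.aemeasurable h0, h2, mul_zero, mul_one]
    congr 1
    ext
    simp [sq_nonneg]
  have hm : Measurable fun x : ℝ => ENNReal.ofReal (|x| ^ p) := by fun_prop
  rw [← lintegral_map' (f := fun x : ℝ => ENNReal.ofReal (|x| ^ p)) hm.aemeasurable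
    hY.aemeasurable, hmap, lintegral_map hm (by fun_prop), gaussianMoment,
    ← lintegral_const_mul _ hm]
  refine lintegral_congr fun x => ?_
  rw [abs_mul, abs_of_nonneg hc, mul_pow, ENNReal.ofReal_mul (by positivity)]

namespace IsFractionalBrownianMotion

lemma integral_sub_sq (hB : IsFractionalBrownianMotion H B P) (hH : 0 < H) (s t : ℝ≥0) :
    ∫ ω, (B t ω - B s ω) ^ 2 ∂P = (|(t : ℝ) - s| ^ H) ^ 2 := by
  have hL2 : ∀ u, MemLp (B u) 2 P := fun u =>
    (hB.isGaussianProcess.hasGaussianLaw_eval u).memLp_two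
  have hint : ∀ u v, Integrable (fun ω => B u ω * B v ω) P := fun u v =>
    (hL2 u).integrable_mul (hL2 v)
  have hexp : ∀ ω, (B t ω - B s ω) ^ 2 =
      (B t ω * B t ω - 2 * (B t ω * B s ω)) + B s ω * B s ω := fun ω => by ring
  simp only [hexp]
  have hdiff : Integrable (fun ω => B t ω * B t ω - 2 * (B t ω * B s ω)) P :=
    (hint t t).sub ((hint t s).const_mul 2)
  rw [integral_add hdiff (hint s s), integral_sub (hint t t) ((hint t s).const_mul 2),
    integral_const_mul, hB.covariance,
    hB.covariance, hB.covariance, ← Real.rpow_natCast, ← Real.rpow_mul (abs_nonneg _)]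
  have : (0 : ℝ) ^ (2 * H) = 0 := Real.zero_rpow (by positivity)
  simp only [sub_self, abs_zero, this]
  rw [mul_comm H]
  push_cast
  ring

lemma lintegral_abs_sub_pow (hB : IsFractionalBrownianMotion H B P) (hH : 0 < H) (s t : ℝ≥0)
    (p : ℕ) :
    ∫⁻ ω, ENNReal.ofReal (|B t ω - B s ω| ^ p) ∂P =
      ENNReal.ofReal ((|(t : ℝ) - s| ^ H) ^ p) * gaussianMoment p := by
  have := hB.isGaussianProcess.isProbabilityMeasure
  have hint := fun u => (hB.isGaussianProcess.hasGaussianLaw_eval u).integrable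
  refine lintegral_abs_pow_of_hasGaussianLaw hB.isGaussianProcess.hasGaussianLaw_fun_sub ?_
    (by positivity) (hB.integral_sub_sq hH s t) p
  rw [integral_sub (hint t) (hint s), hB.centered, hB.centered, sub_zero]

end IsFractionalBrownianMotion

/-- The point with index `j` of the dyadic grid of level `n` on `[0, 2 ^ N]`. -/
noncomputable def gridPoint (N n j : ℕ) : ℝ≥0 := 2 ^ N * ((j : ℝ≥0) / 2 ^ n)

lemma rpow_gridPoint_succ_sub (H : ℝ) (N n j : ℕ) :
    |(gridPoint N n (j + 1) : ℝ) - gridPoint N n j| ^ H = ((2 : ℝ) ^ H) ^ N / (2 ^ H) ^ n := by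
  have : (gridPoint N n (j + 1) : ℝ) - gridPoint N n j = 2 ^ N / 2 ^ n := by
    simp only [gridPoint]
    push_cast
    ring
  rw [this, abs_of_pos (by positivity), Real.div_rpow (by positivity) (by positivity),
    Real.rpow_pow_comm zero_le_two, Real.rpow_pow_comm zero_le_two]

namespace IsFractionalBrownianMotion

/-- With `ρ = 2 ^ H`, Gaussian scaling gives each term expectation `(ρ / b) ^ (p * N) * (q / ρ) ^ (p
* n)` times a fixed moment. Level `n` has `2 ^ n` terms, so the total is a product of geometric
series of ratios `(ρ / b) ^ p` and `2 * (q / ρ) ^ p`. -/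
lemma lintegral_tsum_increments_lt_top (hB : IsFractionalBrownianMotion H B P) (hH : 0 < H)
    {b q : ℝ} {p : ℕ} (hb : (2 : ℝ) ^ H < b) (hq : 0 < q) (hp : p ≠ 0)
    (hqp : 2 * (q / 2 ^ H) ^ p < 1) :
    ∫⁻ ω, ∑' N : ℕ, ∑' n : ℕ, ∑ j ∈ Finset.range (2 ^ n), ENNReal.ofReal
      ((|B (gridPoint N n (j + 1)) ω - B (gridPoint N n j) ω| * (q ^ n / b ^ N)) ^ p) ∂P < ⊤ := by
  set ρ : ℝ := 2 ^ H with hρ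
  have hρ0 : 0 < ρ := by positivity
  have hb0 : 0 < b := hρ0.trans hb
  have hmeas : ∀ N n j : ℕ, AEMeasurable (fun ω => ENNReal.ofReal
      ((|B (gridPoint N n (j + 1)) ω - B (gridPoint N n j) ω| * (q ^ n / b ^ N)) ^ p)) P := by
    intro N n j
    have h1 := hB.isGaussianProcess.aemeasurable (gridPoint N n (j + 1))
    have h2 := hB.isGaussianProcess.aemeasurable (gridPoint N n j)
    fun_prop
  have hmeas' : ∀ N n : ℕ, AEMeasurable (fun ω => ∑ j ∈ Finset.range (2 ^ n), ENNReal.ofReal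
      ((|B (gridPoint N n (j + 1)) ω - B (gridPoint N n j) ω| * (q ^ n / b ^ N)) ^ p)) P :=
    fun N n => Finset.aemeasurable_fun_sum _ fun j _ => hmeas N n j
  have hterm : ∀ N n j : ℕ, ∫⁻ ω, ENNReal.ofReal
      ((|B (gridPoint N n (j + 1)) ω - B (gridPoint N n j) ω| * (q ^ n / b ^ N)) ^ p) ∂P =
      ENNReal.ofReal (((ρ / b) ^ p) ^ N * ((q / ρ) ^ p) ^ n) * gaussianMoment p := by
    intro N n j
    have hsplit : ∀ ω, ENNReal.ofReal
        ((|B (gridPoint N n (j + 1)) ω - B (gridPoint N n j) ω| * (q ^ n / b ^ N)) ^ p) =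
        ENNReal.ofReal ((q ^ n / b ^ N) ^ p) * ENNReal.ofReal
          (|B (gridPoint N n (j + 1)) ω - B (gridPoint N n j) ω| ^ p) := fun ω => by
      rw [mul_comm, mul_pow, ENNReal.ofReal_mul (by positivity)]
    simp only [hsplit]
    rw [lintegral_const_mul' _ _ ENNReal.ofReal_ne_top, hB.lintegral_abs_sub_pow hH,
      rpow_gridPoint_succ_sub, ← hρ, ← mul_assoc, ← ENNReal.ofReal_mul (by positivity)]
    congr 2
    simp only [← pow_mul, mul_comm p, div_pow]
    field_simp
  have hlevel : ∀ N n : ℕ, ∫⁻ ω, ∑ j ∈ Finset.range (2 ^ n), ENNReal.ofReal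
      ((|B (gridPoint N n (j + 1)) ω - B (gridPoint N n j) ω| * (q ^ n / b ^ N)) ^ p) ∂P =
      ENNReal.ofReal ((ρ / b) ^ p) ^ N *
        (ENNReal.ofReal (2 * (q / ρ) ^ p) ^ n * gaussianMoment p) := by
    intro N n
    rw [lintegral_finsetSum' _ fun j _ => hmeas N n j]
    simp only [hterm, Finset.sum_const, Finset.card_range, nsmul_eq_mul]
    rw [← ENNReal.ofReal_pow (by positivity), ← ENNReal.ofReal_pow (by positivity), ← mul_assoc,
      ← mul_assoc, ← ENNReal.ofReal_natCast, ← ENNReal.ofReal_mul (by positivity),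
      ← ENNReal.ofReal_mul (by positivity)]
    congr 2
    push_cast
    rw [mul_pow 2]
    ring
  rw [lintegral_tsum fun N => AEMeasurable.tsum fun n => hmeas' N n]
  simp only [lintegral_tsum fun n => hmeas' _ n, hlevel, ENNReal.tsum_mul_left,
    ENNReal.tsum_mul_right, ENNReal.tsum_geometric]
  have hgeom : ∀ {r : ℝ}, r < 1 → (1 - ENNReal.ofReal r)⁻¹ < ⊤ := fun hr => by
    rw [ENNReal.inv_lt_top, tsub_pos_iff_lt]
    simpa using hr
  refine ENNReal.mul_lt_top (hgeom ?_)
    (ENNReal.mul_lt_top (hgeom hqp) (gaussianMoment_ne_top p).lt_top)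
  exact pow_lt_one₀ (by positivity) ((div_lt_one hb0).2 hb) hp

/-- Almost surely, the dyadic increments over the intervals `[0, 2 ^ N]` are bounded by a multiple of
`b ^ N * q ^ (-n)`, where `n` is the level of the increment. -/
lemma ae_exists_abs_increment_le (hB : IsFractionalBrownianMotion H B P) (hH : 0 < H)
    {b q : ℝ} (hb : (2 : ℝ) ^ H < b) (hq : 0 < q) (hqH : q < 2 ^ H) :
    ∀ᵐ ω ∂P, ∃ C, ∀ N n j : ℕ, j < 2 ^ n →
      |B (gridPoint N n (j + 1)) ω - B (gridPoint N n j) ω| ≤ C * b ^ N * q⁻¹ ^ n := by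
  have hb0 : 0 < b := lt_trans (by positivity) hb
  have hlim : Tendsto (fun p : ℕ => 2 * (q / (2 : ℝ) ^ H) ^ p) atTop (𝓝 (2 * 0)) :=
    (tendsto_pow_atTop_nhds_zero_of_lt_one (by positivity)
      ((div_lt_one (by positivity)).2 hqH)).const_mul 2
  rw [mul_zero] at hlim
  -- A high moment beats the `2 ^ n` increments of level `n`.
  obtain ⟨p, hqp, hp⟩ := ((hlim.eventually_lt_const one_pos).and (eventually_ne_atTop 0)).exists
  have hfin := hB.lintegral_tsum_increments_lt_top hH hb hq hp hqp
  have hmeas : AEMeasurable (fun ω => ∑' N : ℕ, ∑' n : ℕ, ∑ j ∈ Finset.range (2 ^ n),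
      ENNReal.ofReal ((|B (gridPoint N n (j + 1)) ω - B (gridPoint N n j) ω| *
        (q ^ n / b ^ N)) ^ p)) P := by
    refine AEMeasurable.tsum fun N => AEMeasurable.tsum fun n =>
      Finset.aemeasurable_fun_sum _ fun j _ => ?_
    have h1 := hB.isGaussianProcess.aemeasurable (gridPoint N n (j + 1))
    have h2 := hB.isGaussianProcess.aemeasurable (gridPoint N n j)
    fun_prop
  filter_upwards [ae_lt_top' hmeas hfin.ne] with ω hω
  set S := ∑' N : ℕ, ∑' n : ℕ, ∑ j ∈ Finset.range (2 ^ n), ENNReal.ofReal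
    ((|B (gridPoint N n (j + 1)) ω - B (gridPoint N n j) ω| * (q ^ n / b ^ N)) ^ p) with hS
  -- The maximum with `1` avoids a `p`-th root: a number above `1` is at most its `p`-th power,
  -- hence at most `S`.
  refine ⟨max S.toReal 1, fun N n j hj => ?_⟩
  set D := |B (gridPoint N n (j + 1)) ω - B (gridPoint N n j) ω| with hD
  have hle : ENNReal.ofReal ((D * (q ^ n / b ^ N)) ^ p) ≤ S :=
    (Finset.single_le_sum (f := fun j => ENNReal.ofReal
      ((|B (gridPoint N n (j + 1)) ω - B (gridPoint N n j) ω| * (q ^ n / b ^ N)) ^ p))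
      (fun _ _ => zero_le) (Finset.mem_range.2 hj)).trans
      (le_trans (ENNReal.le_tsum (f := fun n => ∑ j ∈ Finset.range (2 ^ n), ENNReal.ofReal
        ((|B (gridPoint N n (j + 1)) ω - B (gridPoint N n j) ω| * (q ^ n / b ^ N)) ^ p)) n)
        (ENNReal.le_tsum N))
  have hbound : D * (q ^ n / b ^ N) ≤ max S.toReal 1 := by
    rw [le_max_iff, or_iff_not_imp_right, not_le]
    exact fun h1 => (le_self_pow₀ h1.le hp).trans ((ENNReal.ofReal_le_iff_le_toReal hω.ne).1 hle)
  calc D = D * (q ^ n / b ^ N) * (b ^ N * q⁻¹ ^ n) := by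
        rw [inv_pow]
        field_simp
    _ ≤ max S.toReal 1 * (b ^ N * q⁻¹ ^ n) := mul_le_mul_of_nonneg_right hbound (by positivity)
    _ = _ := by ring

/-- Almost surely, fractional Brownian motion grows at most like `b ^ N` on `[0, 2 ^ N]`, for each
`b > 2 ^ H`. -/
lemma ae_exists_abs_sub_le (hB : IsFractionalBrownianMotion H B P) (hH : 0 < H)
    (hcont : ∀ᵐ ω ∂P, Continuous fun t => B t ω) {b : ℝ} (hb : (2 : ℝ) ^ H < b) :
    ∀ᵐ ω ∂P, ∃ C, ∀ N : ℕ, ∀ s ∈ Icc (0 : ℝ) (2 ^ N),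
      |path B ω s - path B ω 0| ≤ C * b ^ N := by
  -- `q > 1` makes the chaining series converge; `q < 2 ^ H` keeps the moments summable.
  obtain ⟨q, hq1, hqH⟩ := exists_between (Real.one_lt_rpow one_lt_two hH)
  have hq0 : 0 < q := one_pos.trans hq1
  filter_upwards [hB.ae_exists_abs_increment_le hH hb hq0 hqH, hcont] with ω ⟨C, hC⟩ hc
  refine ⟨C * (1 - q⁻¹)⁻¹, fun N s hs => ?_⟩
  have hpath : Continuous (path B ω) := hc.comp continuous_real_toNNReal
  have hgrid : ∀ n j : ℕ, path B ω (2 ^ N * ((j : ℝ) / 2 ^ n)) = B (gridPoint N n j) ω := by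
    intro n j
    rw [path]
    congr 1
    ext
    rw [Real.coe_toNNReal _ (by positivity)]
    simp [gridPoint]
  -- Rescaling `[0, 2 ^ N]` to the unit interval keeps the chaining factor independent of `N`.
  have h := abs_sub_le_of_continuous (g := fun u => path B ω (2 ^ N * u)) (A := C * b ^ N)
    (r := q⁻¹) (t := s / 2 ^ N) (by fun_prop) (by positivity) (inv_lt_one_of_one_lt₀ hq1)
    (fun n j hj => by
      simp only [hgrid]
      exact hC N n j hj)
    ⟨div_nonneg hs.1 (by positivity), (div_le_one (by positivity)).2 hs.2⟩
  simp only [mul_zero] at h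
  rw [mul_div_cancel₀ s (by positivity)] at h
  linarith

end IsFractionalBrownianMotion

/-! ### Comparison with the square root, and conclusion -/

/-- For `2 ^ N ≤ T < 2 ^ (N + 1)` the left side is at most a constant plus `σ * C * b ^ (N + 1)`,
and the right side is at least `√(a / 2) * √2 ^ N`. After division by `√2 ^ N` the former tends to
zero, as `b < √2`. -/
lemma exists_growth_le_sqrt {x₀ a σ b C : ℝ} {w : ℝ → ℝ} (ha : 0 < a) (hσ : 0 ≤ σ) (hb0 : 0 ≤ b)
    (hb : b < √2) (hC : ∀ N : ℕ, ∀ s ∈ Icc (0 : ℝ) (2 ^ N), |w s - w 0| ≤ C * b ^ N) :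
    ∃ T₀ : ℝ, 0 < T₀ ∧
      ∀ T, T₀ ≤ T → ∀ s ∈ Icc 0 T, |σ * w s| + x₀ + 2 ≤ √(a * T / 2) := by
  have hsqrt : (0 : ℝ) < √2 := by positivity
  have hlim : Tendsto (fun N : ℕ => (σ * |w 0| + x₀ + 2) * (1 / √2) ^ N +
      σ * C * b * (b / √2) ^ N) atTop
      (𝓝 ((σ * |w 0| + x₀ + 2) * 0 + σ * C * b * 0)) := by
    refine ((tendsto_pow_atTop_nhds_zero_of_lt_one (by positivity) ?_).const_mul _).add
      ((tendsto_pow_atTop_nhds_zero_of_lt_one (by positivity) ?_).const_mul _)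
    · rw [div_lt_one hsqrt]
      exact Real.lt_sqrt_of_sq_lt (by norm_num)
    · rwa [div_lt_one hsqrt]
  rw [mul_zero, mul_zero, add_zero] at hlim
  obtain ⟨N₀, hN₀⟩ := eventually_atTop.1
    (hlim.eventually_le_const (show (0 : ℝ) < √(a / 2) by positivity))
  refine ⟨2 ^ N₀, by positivity, fun T hT s hs => ?_⟩
  obtain ⟨N, hN, hN'⟩ := exists_nat_pow_near
    (le_trans (one_le_pow₀ one_le_two) hT : (1 : ℝ) ≤ T) one_lt_two
  have hle : N₀ ≤ N :=
    Nat.lt_succ_iff.1 ((pow_lt_pow_iff_right₀ (one_lt_two (α := ℝ))).1 (hT.trans_lt hN'))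
  have h1 : |w s| ≤ |w 0| + C * b ^ (N + 1) := by
    have := hC (N + 1) s ⟨hs.1, hs.2.trans hN'.le⟩
    have := abs_sub_abs_le_abs_sub (w s) (w 0)
    linarith
  have h2 : √(a / 2) * √2 ^ N ≤ √(a * T / 2) := by
    refine Real.le_sqrt_of_sq_le ?_
    rw [mul_pow, Real.sq_sqrt (by positivity), ← pow_mul, mul_comm N, pow_mul,
      Real.sq_sqrt zero_le_two, mul_div_right_comm]
    exact mul_le_mul_of_nonneg_left hN (by positivity)
  have h3 := mul_le_mul_of_nonneg_right (hN₀ N hle) (show 0 ≤ √2 ^ N by positivity)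
  have h4 : ((σ * |w 0| + x₀ + 2) * (1 / √2) ^ N + σ * C * b * (b / √2) ^ N) * √2 ^ N =
      σ * |w 0| + x₀ + 2 + σ * (C * b ^ (N + 1)) := by
    rw [div_pow, div_pow, one_pow, pow_succ]
    field_simp
  rw [h4] at h3
  have h5 := mul_le_mul_of_nonneg_left h1 hσ
  rw [abs_mul, abs_of_nonneg hσ]
  linarith

end RoughBessel

theorem mainTheorem5 {Ω : Type*} [MeasurableSpace Ω] (P : Measure Ω) [IsProbabilityMeasure P]
    (H x₀ a σ : ℝ) (hH₀ : 0 < H) (hH : H < 1 / 2) (hx₀ : 0 < x₀) (ha : 0 < a) (hσ : 0 < σ)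
    (B : ℝ≥0 → Ω → ℝ) (hB : RoughBessel.IsFractionalBrownianMotion H B P)
    (hcont : ∀ᵐ ω ∂P, Continuous fun t => B t ω) :
    ∀ᵐ ω ∂P,
      -- the limits defining `X` and `L` exist and are finite
      (∀ t : ℝ, 0 ≤ t →
        Tendsto (fun ε => RoughBessel.preLimit x₀ a σ (RoughBessel.path B ω) ε t) (𝓝[>] 0)
          (𝓝 (RoughBessel.roughBessel x₀ a σ (RoughBessel.path B ω) t)) ∧
        Tendsto (fun ε => RoughBessel.preL x₀ a σ (RoughBessel.path B ω) ε t) (𝓝[>] 0)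
          (𝓝 (RoughBessel.processL x₀ a σ (RoughBessel.path B ω) t))) ∧
      -- the integral of `1 / X` over `[0, t]` is well defined and finite
      (∀ᵐ s ∂(volume.restrict (Ici (0 : ℝ))),
        0 < RoughBessel.roughBessel x₀ a σ (RoughBessel.path B ω) s) ∧
      (∀ t : ℝ, 0 ≤ t → IntervalIntegrable
        (fun s => 1 / RoughBessel.roughBessel x₀ a σ (RoughBessel.path B ω) s) volume 0 t) ∧
      ∃ τ : ℝ, 0 < τ ∧ ∀ t₁ t₂ : ℝ, τ ≤ t₁ → t₁ < t₂ →
        RoughBessel.processR x₀ a σ (RoughBessel.path B ω) t₁ =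
          RoughBessel.processR x₀ a σ (RoughBessel.path B ω) t₂ ∧
        RoughBessel.processL x₀ a σ (RoughBessel.path B ω) t₂ -
            RoughBessel.processL x₀ a σ (RoughBessel.path B ω) t₁ =
          ∫ s in t₁..t₂, 1 / RoughBessel.roughBessel x₀ a σ (RoughBessel.path B ω) s ∧
        RoughBessel.roughBessel x₀ a σ (RoughBessel.path B ω) t₂ -
            RoughBessel.roughBessel x₀ a σ (RoughBessel.path B ω) t₁ =
          a * (∫ s in t₁..t₂, 1 / RoughBessel.roughBessel x₀ a σ (RoughBessel.path B ω) s) +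
            σ * (RoughBessel.path B ω t₂ - RoughBessel.path B ω t₁) := by
  -- The only use of `H < 1 / 2`: it leaves room for a growth rate `b` strictly between `2 ^ H` and
  -- `√2`.
  have hb : (2 : ℝ) ^ H < √2 := by
    rw [Real.sqrt_eq_rpow]
    exact Real.rpow_lt_rpow_of_exponent_lt one_lt_two hH
  obtain ⟨b, hHb, hb2⟩ := exists_between hb
  have hb0 : 0 ≤ b := le_trans (by positivity) hHb.le
  filter_upwards [hB.ae_exists_abs_sub_le hH₀ hcont hHb, hcont] with ω ⟨C, hC⟩ hc
  have hw : Continuous (RoughBessel.path B ω) := hc.comp continuous_real_toNNReal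
  refine ⟨fun t ht => ⟨RoughBessel.tendsto_preLimit x₀ σ ha.le hw ht,
    RoughBessel.tendsto_preL x₀ σ ha hw ht⟩, RoughBessel.ae_roughBessel_pos x₀ σ ha hw,
    fun t ht => RoughBessel.intervalIntegrable_one_div_roughBessel x₀ σ ha hw ht, ?_⟩
  obtain ⟨τ, hτ, hgrow⟩ := RoughBessel.exists_growth_le_sqrt (x₀ := x₀) ha hσ.le hb0 hb2 hC
  refine ⟨τ, hτ, fun t₁ t₂ h₁ h₂ => ?_⟩
  have ht₁ : 0 ≤ t₁ := hτ.le.trans h₁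
  have ht₂ : 0 ≤ t₂ := ht₁.trans h₂.le
  have hL := RoughBessel.processL_sub_processL hx₀.le ha hw hτ.le hgrow h₁ h₂.le
  refine ⟨?_, hL, ?_⟩
  · have := intervalIntegral.integral_interval_sub_left
      (RoughBessel.intervalIntegrable_one_div_roughBessel x₀ σ ha hw ht₂)
      (RoughBessel.intervalIntegrable_one_div_roughBessel x₀ σ ha hw ht₁)
    unfold RoughBessel.processR
    linarith
  · rw [RoughBessel.roughBessel_eq x₀ σ ha hw ht₁, RoughBessel.roughBessel_eq x₀ σ ha hw ht₂, ← hL]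
    ring
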